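/- Let $(\Omega,\mu)$ be a measure space, $E$ a reflexive real Banach space, $1\le p\le\infty$, $1\le q<\infty$, and let $I\colon L^p(\Omega,E)\to L^\infty(\Omega,E)$ be a continuous linear map. Let $f\colon\Omega\times E\to E$ be a weak Carathéodory map, i.e. $x\mapsto f(x,u)$ is (strongly) measurable for each $u\in E$, and for almost every $x\in\Omega$ the map $u\mapsto f(x,u)$ is sequentially weakly continuous (it maps every sequence converging weakly to some $u$ to a sequence converging weakly to $f(x,u)$). Suppose that $$\|f(x,u)\|_E\le A(x)\,\psi(\|u\|_E)\qquad\text{for a.e. }x\in\Omega\text{ and all }u\in E,$$ where $A\in L^q(\Omega)$ and $\psi\colon\mathbb R\to\mathbb R$ restricts to an element of $L^\infty([0,R])$ for every $R>0$. Assume that $q>1$ or $p=q=1$. Then for every $v\in L^p(\Omega,E)$ the function $x\mapsto f(x,(Iv)(x))$ belongs to $L^q(\Omega,E)$, and the map $$\Psi=N_f\circ I\colon L^p(\Omega,E)\to L^q(\Omega,E),\qquad \Psi(v)(x)=f\bigl(x,(Iv)(x)\bigr),$$ is sequentially weakly continuous: if $v_n\rightharpoonup v$ weakly in $L^p(\Omega,E)$,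 then $\Psi(v_n)\rightharpoonup\Psi(v)$ weakly in $L^q(\Omega,E)$. -/

import Mathlib

open MeasureTheory Filter Topology
open scoped ENNReal

/-- A real normed space is reflexive if its canonical embedding into the bidual is onto. -/
def IsReflexive (E : Type*) [NormedAddCommGroup E] [NormedSpace ℝ E] : Prop :=
  Function.Surjective (NormedSpace.inclusionInDoubleDual ℝ E)

/-- `u n` converges to `a` in the weak topology of `X`. -/
def TendstoWeakly {X : Type*} [NormedAddCommGroup X] [NormedSpace ℝ X]
    (u : ℕ → X) (a : X) : Prop :=
  Tendsto (fun n => toWeakSpace ℝ X (u n)) atTop (𝓝 (toWeakSpace ℝ X a))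

/-- A map is sequentially weakly continuous if it maps weakly convergent sequences to weakly
convergent sequences, with the corresponding limits. -/
def SeqWeaklyContinuous {X Y : Type*} [NormedAddCommGroup X] [NormedSpace ℝ X]
    [NormedAddCommGroup Y] [NormedSpace ℝ Y] (T : X → Y) : Prop :=
  ∀ (u : ℕ → X) (a : X), TendstoWeakly u a → TendstoWeakly (fun n => T (u n)) (T a)

/-- Weak Carathéodory maps: measurable in the first variable (in the Bochner sense, up to null
sets), and sequentially weakly continuous in the second one for almost every value of the
first. -/
structure IsWeakCaratheodory {Ω E : Type*} [MeasurableSpace Ω] [NormedAddCommGroup E]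
    [NormedSpace ℝ E] (μ : Measure Ω) (f : Ω → E → E) : Prop where
  aestronglyMeasurable : ∀ u : E, AEStronglyMeasurable (fun x => f x u) μ
  seqWeaklyContinuous : ∀ᵐ x ∂μ, SeqWeaklyContinuous (f x)

/-- The space `L^∞_loc([0, ∞))`: functions in `L^∞(0, R)` for every `R`. -/
def MemLinftyLoc (ψ : ℝ → ℝ) : Prop :=
  ∀ R : ℝ, MemLp ψ ∞ (volume.restrict (Set.Icc 0 R))

/-- The Nemytskii (substitution) operator `N_f` of `f`, on functions. -/
def nemytskii {Ω E : Type*} (f : Ω → E → E) (v : Ω → E) : Ω → E :=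
  fun x => f x (v x)

/-! Since `I` is bounded, `I (v n)` converges weakly in `L^∞`. The core of the proof is two passages
between weak convergence of functions and of their values.

From `L^∞` to points (`TendstoWeakly.ae_of_Lp_top`): outside one null set, every finite combination
of the functions has norm at `x` at most its `L^∞` norm. Thus "evaluate at `x`, then apply `ξ`" is
bounded on the span of the sequence and its limit, and Hahn-Banach extends it to a functional on
`L^∞`. Sequential weak continuity of `f x` then gives pointwise weak convergence of the images, and
the growth condition dominates them by a multiple of `|A|`.

From points to `L^q` (`tendstoWeakly_toLp_of_ae_dominated`): cutting off small tails leaves bounded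
functions on a set of finite measure. There a functional on `L^q` is integration against a
dual-valued density, at least on functions with values in a given separable set
(`exists_dual_density`, `integral_dual_density`), and scalar dominated convergence applies. -/

/-! ### Weak convergence in normed spaces -/

theorem tendstoWeakly_iff {X : Type*} [NormedAddCommGroup X] [NormedSpace ℝ X]
    {u : ℕ → X} {a : X} :
    TendstoWeakly u a ↔ ∀ ξ : StrongDual ℝ X, Tendsto (fun n => ξ (u n)) atTop (𝓝 (ξ a)) := by
  have hinj : Function.Injective (topDualPairing ℝ X).flip := by
    intro x y hxy
    refine (SeparatingDual.eq_iff_forall_dual_eq (R := ℝ)).2 fun ξ => ?_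
    exact LinearMap.congr_fun hxy ξ
  exact WeakBilin.tendsto_iff_forall_eval_tendsto (topDualPairing ℝ X).flip hinj

theorem TendstoWeakly.exists_norm_le {X : Type*} [NormedAddCommGroup X] [NormedSpace ℝ X]
    {u : ℕ → X} {a : X} (h : TendstoWeakly u a) : ∃ R, ∀ n, ‖u n‖ ≤ R := by
  rw [tendstoWeakly_iff] at h
  obtain ⟨R, hR⟩ := banach_steinhaus (g := fun n => NormedSpace.inclusionInDoubleDual ℝ X (u n))
    (fun ξ => by
      obtain ⟨C, hC⟩ := (h ξ).norm.bddAbove_range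
      exact ⟨C, fun n => by simpa using hC ⟨n, rfl⟩⟩)
  refine ⟨R, fun n => ?_⟩
  have h1 := (NormedSpace.inclusionInDoubleDualLi ℝ (E := X)).norm_map (u n)
  exact h1 ▸ hR n

theorem TendstoWeakly.map {X Y : Type*} [NormedAddCommGroup X] [NormedSpace ℝ X]
    [NormedAddCommGroup Y] [NormedSpace ℝ Y] {u : ℕ → X} {a : X} (h : TendstoWeakly u a)
    (T : X →L[ℝ] Y) : TendstoWeakly (fun n => T (u n)) (T a) := by
  rw [tendstoWeakly_iff] at h ⊢
  exact fun ξ => h (ξ.comp T)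

theorem tendstoWeakly_of_tendsto {X : Type*} [NormedAddCommGroup X] [NormedSpace ℝ X]
    {u : ℕ → X} {a : X} (h : Tendsto u atTop (𝓝 a)) : TendstoWeakly u a :=
  tendstoWeakly_iff.2 fun ξ => (ξ.continuous.tendsto a).comp h

/-- Weak lower semicontinuity of the norm, seen by testing on a norming functional of the limit. -/
theorem TendstoWeakly.norm_le {X : Type*} [NormedAddCommGroup X] [NormedSpace ℝ X]
    {u : ℕ → X} {a : X} (h : TendstoWeakly u a) {C : ℝ} (hC : ∀ n, ‖u n‖ ≤ C) : ‖a‖ ≤ C := by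
  obtain ⟨ξ, hξ, hξa⟩ := exists_dual_vector'' ℝ a
  have hlim := tendstoWeakly_iff.1 h ξ
  rw [hξa] at hlim
  refine le_of_tendsto hlim (Eventually.of_forall fun n => ?_)
  calc ξ (u n) ≤ ‖ξ (u n)‖ := Real.le_norm_self _
    _ ≤ 1 * ‖u n‖ := ξ.le_of_opNorm_le hξ _
    _ ≤ C := by simpa using hC n

/-! ### Functionals prescribed on countable families -/

/-- A linear functional dominated by the norm of the image under a linear map `π` factors through
a bounded functional. -/
theorem exists_strongDual_comp_eq {V X : Type*} [AddCommGroup V] [Module ℝ V]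
    [NormedAddCommGroup X] [NormedSpace ℝ X] (π : V →ₗ[ℝ] X) (L : V →ₗ[ℝ] ℝ) {C : ℝ}
    (hC : 0 ≤ C) (h : ∀ v, L v ≤ C * ‖π v‖) :
    ∃ F : StrongDual ℝ X, ‖F‖ ≤ C ∧ ∀ v, F (π v) = L v := by
  have habs : ∀ v, |L v| ≤ C * ‖π v‖ := fun v =>
    abs_le'.2 ⟨h v, by simpa using h (-v)⟩
  have hker : LinearMap.ker π.rangeRestrict ≤ LinearMap.ker L := by
    intro v hv
    have hv0 : π v = 0 := by simpa using congrArg Subtype.val (LinearMap.mem_ker.1 hv)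
    have := habs v
    rw [hv0, norm_zero, mul_zero] at this
    exact LinearMap.mem_ker.2 (abs_nonpos_iff.1 this)
  -- `L` vanishes on `ker π`, so it descends to the range of `π`; Hahn-Banach then extends it with
  -- the same norm.
  obtain ⟨G, hG⟩ := (LinearMap.range_dualMap_eq_dualAnnihilator_ker π.rangeRestrict ▸
    (Submodule.mem_dualAnnihilator _).2 fun v hv => hker hv :
      L ∈ LinearMap.range π.rangeRestrict.dualMap)
  have hGL : ∀ v, G (π.rangeRestrict v) = L v := fun v => LinearMap.congr_fun hG v
  have hGC : ∀ y, ‖G y‖ ≤ C * ‖y‖ := by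
    intro y
    obtain ⟨v, rfl⟩ := LinearMap.surjective_rangeRestrict π y
    rw [hGL]
    exact habs v
  obtain ⟨F, hF, hFn⟩ := exists_extension_norm_eq (LinearMap.range π) (G.mkContinuous C hGC)
  refine ⟨F, hFn ▸ G.mkContinuous_norm_le hC hGC, fun v => ?_⟩
  have := hF (π.rangeRestrict v)
  rw [LinearMap.mkContinuous_apply, hGL] at this
  exact this

/-- If, for each finite combination with coefficients in a dense sequence, a bound holds, then the
assignment `e i ↦ φ i` is given by a bounded functional. -/
theorem exists_strongDual_apply_eq {X : Type*} [NormedAddCommGroup X] [NormedSpace ℝ X]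
    (e : ℕ → X) (φ : ℕ → ℝ) {C : ℝ} (hC : 0 ≤ C)
    (h : ∀ (s : Finset ℕ) (k : ℕ),
      ∑ i ∈ s, TopologicalSpace.denseSeq (ℕ → ℝ) k i * φ i ≤
        C * ‖∑ i ∈ s, TopologicalSpace.denseSeq (ℕ → ℝ) k i • e i‖) :
    ∃ F : StrongDual ℝ X, ‖F‖ ≤ C ∧ ∀ i, F (e i) = φ i := by
  have hall : ∀ (s : Finset ℕ) (c : ℕ → ℝ), ∑ i ∈ s, c i * φ i ≤ C * ‖∑ i ∈ s, c i • e i‖ := by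
    intro s c
    refine (TopologicalSpace.denseRange_denseSeq (ℕ → ℝ)).induction_on
      (p := fun c : ℕ → ℝ => ∑ i ∈ s, c i * φ i ≤ C * ‖∑ i ∈ s, c i • e i‖) c ?_ (h s)
    exact isClosed_le (by fun_prop) (by fun_prop)
  obtain ⟨F, hF, hFe⟩ := exists_strongDual_comp_eq (V := ℕ →₀ ℝ) (Finsupp.linearCombination ℝ e)
    (Finsupp.linearCombination ℝ φ) hC (fun v => by
      simpa [Finsupp.linearCombination_apply, Finsupp.sum] using hall v.support v)
  refine ⟨F, hF, fun i => ?_⟩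
  simpa using hFe (Finsupp.single i 1)

/-! ### From weak convergence in `L^∞` to weak convergence of values -/

theorem MeasureTheory.Lp.ae_norm_le_norm_top {Ω : Type*} [MeasurableSpace Ω] {μ : Measure Ω}
    {E : Type*} [NormedAddCommGroup E] (w : Lp E ∞ μ) : ∀ᵐ x ∂μ, ‖w x‖ ≤ ‖w‖ := by
  filter_upwards [enorm_ae_le_eLpNormEssSup w μ] with x hx
  rw [← eLpNorm_exponent_top] at hx
  rw [Lp.norm_def, ← toReal_enorm]
  exact ENNReal.toReal_mono (Lp.eLpNorm_ne_top w) hx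

/-- Weak convergence in `L^∞` implies weak convergence of almost all values. -/
theorem TendstoWeakly.ae_of_Lp_top {Ω : Type*} [MeasurableSpace Ω] {μ : Measure Ω}
    {E : Type*} [NormedAddCommGroup E] [NormedSpace ℝ E] {w : ℕ → Lp E ∞ μ} {a : Lp E ∞ μ}
    (h : TendstoWeakly w a) : ∀ᵐ x ∂μ, TendstoWeakly (fun n => w n x) (a x) := by
  -- The limit sits at index 0 and `w n` at `n + 1`, so that a single functional `F` handles both.
  let g : ℕ → Lp E ∞ μ := fun n => Nat.casesOn n a w
  -- Coefficients from a countable dense set suffice, and keep the exceptional set null.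
  have key : ∀ᵐ x ∂μ, ∀ (s : Finset ℕ) (k : ℕ),
      ‖∑ i ∈ s, TopologicalSpace.denseSeq (ℕ → ℝ) k i • g i x‖ ≤
        ‖∑ i ∈ s, TopologicalSpace.denseSeq (ℕ → ℝ) k i • g i‖ := by
    rw [ae_all_iff]
    intro s
    rw [ae_all_iff]
    intro k
    set c := TopologicalSpace.denseSeq (ℕ → ℝ) k
    have h1 : ∀ᵐ x ∂μ, (∑ i ∈ s, c i • g i : Lp E ∞ μ) x = ∑ i ∈ s, c i • g i x := by
      have h2 := Lp.coeFn_finsetSum s (fun i => c i • g i)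
      have h3 : ∀ᵐ x ∂μ, ∀ i, (c i • g i : Lp E ∞ μ) x = c i • g i x :=
        ae_all_iff.2 fun i => Lp.coeFn_smul (c i) (g i)
      filter_upwards [h2, h3] with x hx2 hx3
      rw [hx2]
      simp [hx3]
    filter_upwards [h1, Lp.ae_norm_le_norm_top (∑ i ∈ s, c i • g i)] with x hx1 hx2
    rwa [← hx1]
  filter_upwards [key] with x hx
  refine tendstoWeakly_iff.2 fun ξ => ?_
  obtain ⟨F, -, hF⟩ := exists_strongDual_apply_eq g (fun i => ξ (g i x)) (norm_nonneg ξ)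
    (fun s k => by
      calc ∑ i ∈ s, TopologicalSpace.denseSeq (ℕ → ℝ) k i * ξ (g i x)
          = ξ (∑ i ∈ s, TopologicalSpace.denseSeq (ℕ → ℝ) k i • g i x) := by simp
        _ ≤ ‖ξ (∑ i ∈ s, TopologicalSpace.denseSeq (ℕ → ℝ) k i • g i x)‖ := Real.le_norm_self _
        _ ≤ _ := (ξ.le_opNorm _).trans (mul_le_mul_of_nonneg_left (hx s k) (norm_nonneg ξ)))
  have h4 := tendstoWeakly_iff.1 h F
  have h5 : ∀ n, F (w n) = ξ (w n x) := fun n => hF (n + 1)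
  have h6 : F a = ξ (a x) := hF 0
  simpa only [h5, h6] using h4

/-! ### Measurability of weak limits and of the Nemytskii operator -/

/-- An everywhere weak limit of strongly measurable functions is strongly measurable. -/
theorem stronglyMeasurable_of_tendstoWeakly {Ω : Type*} [MeasurableSpace Ω]
    {E : Type*} [NormedAddCommGroup E] [NormedSpace ℝ E] {G : ℕ → Ω → E} {g : Ω → E}
    (hG : ∀ n, StronglyMeasurable (G n)) (h : ∀ x, TendstoWeakly (fun n => G n x) (g x)) :
    StronglyMeasurable g := by
  borelize E
  have hsep : TopologicalSpace.IsSeparable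
      (Submodule.span ℝ (⋃ n, Set.range (G n)) : Set E) :=
    (TopologicalSpace.IsSeparable.iUnion fun n => (hG n).isSeparable_range).span
  obtain ⟨c, hc, hcl⟩ := hsep
  -- A norm-closed subspace is weakly closed, so the limit stays in the separable closed span of the
  -- values of the `G n`.
  have hgc : ∀ x, g x ∈ closure c := by
    intro x
    refine closure_minimal hcl isClosed_closure ?_
    by_contra hx
    obtain ⟨ξ, r, hξ, hr⟩ := geometric_hahn_banach_closed_point
      (Submodule.convex (Submodule.span ℝ (⋃ n, Set.range (G n)))).closure isClosed_closure hx
    refine hr.not_ge (le_of_tendsto (tendstoWeakly_iff.1 (h x) ξ) (Eventually.of_forall fun n => ?_))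
    exact (hξ _ (subset_closure (Submodule.subset_span (Set.mem_iUnion.2 ⟨n, x, rfl⟩)))).le
  choose ξ hξ1 hξ2 using fun y : E => exists_dual_vector'' ℝ y
  have hmeas : ∀ η : StrongDual ℝ E, Measurable fun x => η (g x) := fun η =>
    measurable_of_tendsto_metrizable
      (fun n => (η.continuous.comp_stronglyMeasurable (hG n)).measurable)
      (tendsto_pi_nhds.2 fun x => tendstoWeakly_iff.1 (h x) η)
  have hball : ∀ (e : E) (r : ℝ), MeasurableSet (g ⁻¹' Metric.closedBall e r) := by
    intro e r
    -- As `c` is dense around the values of `g`, the norm of `g x - e` is the supremum of `ξ (d - e)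
    -- (g x - e)` over `d ∈ c`, with `ξ y` norming for `y`: a countable family of measurable
    -- conditions.
    have heq : g ⁻¹' Metric.closedBall e r = ⋂ d ∈ c, {x | ξ (d - e) (g x) - ξ (d - e) e ≤ r} := by
      ext x
      simp only [Set.mem_preimage, Metric.mem_closedBall, dist_eq_norm, Set.mem_iInter,
        Set.mem_ofPred_eq]
      constructor
      · intro hx d _
        rw [← map_sub]
        calc _ ≤ ‖ξ (d - e) (g x - e)‖ := Real.le_norm_self _
          _ ≤ 1 * ‖g x - e‖ := (ξ (d - e)).le_of_opNorm_le (hξ1 _) _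
          _ ≤ r := by simpa using hx
      · intro hx
        refine le_of_forall_pos_le_add fun ε hε => ?_
        obtain ⟨d, hd, hdx⟩ := Metric.mem_closure_iff.1 (hgc x) (ε / 2) (by positivity)
        have h1 := hx d hd
        have h2 : ξ (d - e) (d - e) = ‖d - e‖ := hξ2 _
        have h3 : ξ (d - e) (d - g x) ≤ ‖d - g x‖ := by
          calc _ ≤ ‖ξ (d - e) (d - g x)‖ := Real.le_norm_self _
            _ ≤ 1 * ‖d - g x‖ := (ξ (d - e)).le_of_opNorm_le (hξ1 _) _
            _ = _ := one_mul _
        have h4 : ‖g x - e‖ ≤ ‖d - e‖ + ‖d - g x‖ := by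
          calc ‖g x - e‖ = ‖(d - e) - (d - g x)‖ := by congr 1; abel
            _ ≤ _ := norm_sub_le _ _
        rw [dist_comm, dist_eq_norm] at hdx
        rw [map_sub] at h2 h3
        linarith
    rw [heq]
    exact MeasurableSet.biInter hc fun d _ =>
      measurableSet_le ((hmeas _).sub_const _) measurable_const
  refine stronglyMeasurable_iff_measurable_separable.2 ⟨measurable_of_isOpen fun U hU => ?_,
    c, hc, Set.range_subset_iff.2 hgc⟩
  have heq : g ⁻¹' U = ⋃ d ∈ c, ⋃ r : ℚ, ⋃ _ : Metric.closedBall d (r : ℝ) ⊆ U,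
      g ⁻¹' Metric.closedBall d (r : ℝ) := by
    ext x
    simp only [Set.mem_preimage, Set.mem_iUnion, exists_prop]
    constructor
    · intro hx
      obtain ⟨ε, hε, hεU⟩ := Metric.isOpen_iff.1 hU _ hx
      obtain ⟨r, hr0, hrε⟩ := exists_rat_btwn (half_pos hε)
      obtain ⟨d, hd, hdx⟩ := Metric.mem_closure_iff.1 (hgc x) r hr0
      refine ⟨d, hd, r, fun y hy => hεU ?_, hdx.le⟩
      rw [Metric.mem_closedBall] at hy
      rw [Metric.mem_ball]
      have := dist_triangle y d (g x)
      rw [dist_comm d] at this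
      linarith
    · rintro ⟨d, _, r, hr, hx⟩
      exact hr hx
  rw [heq]
  exact MeasurableSet.biUnion hc fun d _ => MeasurableSet.iUnion fun r =>
    MeasurableSet.iUnion fun _ => hball _ _

theorem aestronglyMeasurable_of_tendstoWeakly {Ω : Type*} [MeasurableSpace Ω] {μ : Measure Ω}
    {E : Type*} [NormedAddCommGroup E] [NormedSpace ℝ E] {G : ℕ → Ω → E} {g : Ω → E}
    (hG : ∀ n, AEStronglyMeasurable (G n) μ)
    (h : ∀ᵐ x ∂μ, TendstoWeakly (fun n => G n x) (g x)) :
    AEStronglyMeasurable g μ := by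
  have hae : ∀ᵐ x ∂μ, (∀ n, G n x = (hG n).mk _ x) ∧ TendstoWeakly (fun n => G n x) (g x) :=
    (ae_all_iff.2 fun n => (hG n).ae_eq_mk).and h
  obtain ⟨S, hSae, hSm, hS⟩ := hae.exists_measurable_mem
  have hmeas : StronglyMeasurable (S.indicator g) := by
    refine stronglyMeasurable_of_tendstoWeakly
      (fun n => (hG n).stronglyMeasurable_mk.indicator hSm) fun x => ?_
    by_cases hx : x ∈ S
    · simp only [Set.indicator_of_mem hx]
      have := (hS x hx).2
      simpa only [(hS x hx).1] using this
    · simp only [Set.indicator_of_notMem hx]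
      exact tendstoWeakly_of_tendsto tendsto_const_nhds
  refine hmeas.aestronglyMeasurable.congr ?_
  filter_upwards [hSae] with x hx
  exact Set.indicator_of_mem hx g

theorem aestronglyMeasurable_nemytskii_simpleFunc {Ω E : Type*} [MeasurableSpace Ω]
    [NormedAddCommGroup E] {μ : Measure Ω} {f : Ω → E → E}
    (hf : ∀ u : E, AEStronglyMeasurable (fun x => f x u) μ) (s : SimpleFunc Ω E) :
    AEStronglyMeasurable (nemytskii f s) μ := by
  classical
  have heq : nemytskii f s = fun x => ∑ c ∈ s.range, (s ⁻¹' {c}).indicator (fun x => f x c) x := by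
    ext x
    rw [Finset.sum_eq_single (s x)]
    · simp [nemytskii]
    · intro c _ hc
      exact Set.indicator_of_notMem (fun h => hc h.symm) _
    · intro hx
      exact absurd (s.mem_range_self x) hx
  rw [heq]
  exact Finset.aestronglyMeasurable_fun_sum _ fun c _ =>
    (hf c).indicator (s.measurableSet_fiber c)

/-- Simple functions approximate `w` in norm, but `f x` preserves this only as weak convergence;
hence the need for measurability of weak limits. -/
theorem IsWeakCaratheodory.aestronglyMeasurable_nemytskii {Ω E : Type*} [MeasurableSpace Ω]
    [NormedAddCommGroup E] [NormedSpace ℝ E] {μ : Measure Ω} {f : Ω → E → E}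
    (hf : IsWeakCaratheodory μ f) {w : Ω → E} (hw : AEStronglyMeasurable w μ) :
    AEStronglyMeasurable (nemytskii f w) μ := by
  have hmk : AEStronglyMeasurable (nemytskii f (hw.mk w)) μ := by
    refine aestronglyMeasurable_of_tendstoWeakly (fun n =>
      aestronglyMeasurable_nemytskii_simpleFunc hf.aestronglyMeasurable
        (hw.stronglyMeasurable_mk.approx n)) ?_
    filter_upwards [hf.seqWeaklyContinuous] with x hx
    exact hx _ _ (tendstoWeakly_of_tendsto (hw.stronglyMeasurable_mk.tendsto_approx x))
  refine hmk.congr ?_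
  filter_upwards [hw.ae_eq_mk] with x hx
  simp only [nemytskii, hx]

/-! ### The growth condition -/

/-- The growth condition with `ψ` only locally essentially bounded gives a bound on balls. -/
theorem IsWeakCaratheodory.exists_norm_le {Ω E : Type*} [MeasurableSpace Ω]
    [NormedAddCommGroup E] [NormedSpace ℝ E] {μ : Measure Ω} {f : Ω → E → E}
    (hf : IsWeakCaratheodory μ f) {A : Ω → ℝ} {ψ : ℝ → ℝ} (hψ : MemLinftyLoc ψ)
    (hbound : ∀ᵐ x ∂μ, ∀ u : E, ‖f x u‖ ≤ A x * ψ ‖u‖) (R : ℝ) :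
    ∃ C : ℝ, 0 ≤ C ∧ ∀ᵐ x ∂μ, ∀ u : E, ‖u‖ ≤ R → ‖f x u‖ ≤ C * ‖A x‖ := by
  obtain ⟨C, hC0, hC⟩ : ∃ C : ℝ, 0 ≤ C ∧
      ∀ᵐ t ∂(volume.restrict (Set.Icc 0 (R + 1))), ‖ψ t‖ ≤ C := by
    refine ⟨(eLpNorm ψ ∞ (volume.restrict (Set.Icc 0 (R + 1)))).toReal, ENNReal.toReal_nonneg, ?_⟩
    filter_upwards [enorm_ae_le_eLpNormEssSup ψ (volume.restrict (Set.Icc 0 (R + 1)))] with t ht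
    rw [← eLpNorm_exponent_top] at ht
    rw [← toReal_enorm]
    exact ENNReal.toReal_mono (hψ (R + 1)).eLpNorm_ne_top ht
  refine ⟨C, hC0, ?_⟩
  filter_upwards [hf.seqWeaklyContinuous, hbound] with x hx hb u hu
  have hgood : ∀ v : E, ‖ψ ‖v‖‖ ≤ C → ‖f x v‖ ≤ C * ‖A x‖ := fun v hv =>
    calc ‖f x v‖ ≤ A x * ψ ‖v‖ := hb v
      _ ≤ ‖A x * ψ ‖v‖‖ := Real.le_norm_self _
      _ = ‖ψ ‖v‖‖ * ‖A x‖ := by rw [norm_mul, mul_comm]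
      _ ≤ C * ‖A x‖ := by gcongr
  obtain ht | ht := subsingleton_or_nontrivial E
  · rw [Subsingleton.elim (f x u) 0, norm_zero]
    positivity
  obtain ⟨e, he, hue⟩ : ∃ e : E, ‖e‖ = 1 ∧ u = ‖u‖ • e := by
    by_cases hu0 : u = 0
    · obtain ⟨e, he⟩ := exists_norm_eq E zero_le_one
      exact ⟨e, he, by simp [hu0]⟩
    · exact ⟨‖u‖⁻¹ • u, by simp [norm_smul, hu0], by simp [smul_smul, hu0]⟩
  -- `‖u‖` itself may lie in the exceptional null set of `ψ`. Good radii decreasing to `‖u‖` exist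
  -- in every interval to its right, and `R + 1` leaves room for them. The bound passes to `u` by
  -- weak lower semicontinuity of the norm.
  have hex : ∀ k : ℕ, ∃ t : ℝ, ‖u‖ < t ∧ t < ‖u‖ + 1 / (k + 1) ∧ ‖ψ t‖ ≤ C := by
    intro k
    have hk : (0 : ℝ) < 1 / (k + 1) := by positivity
    have hk1 : (1 : ℝ) / (k + 1) ≤ 1 := by
      rw [div_le_one (by positivity)]
      linarith [(Nat.cast_nonneg k : (0 : ℝ) ≤ k)]
    have hsub : Set.Ioo ‖u‖ (‖u‖ + 1 / (k + 1)) ⊆ Set.Icc 0 (R + 1) := fun t ht =>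
      ⟨(norm_nonneg u).trans ht.1.le, by linarith [ht.2]⟩
    have hC' := ae_restrict_of_ae_restrict_of_subset hsub hC
    have hne : (ae (volume.restrict (Set.Ioo ‖u‖ (‖u‖ + 1 / ((k : ℝ) + 1))))).NeBot := by
      rw [ae_restrict_neBot, Real.volume_Ioo]
      simp
      positivity
    obtain ⟨t, ht1, ht2⟩ := (hC'.and (ae_restrict_mem measurableSet_Ioo)).exists
    exact ⟨t, ht2.1, ht2.2, ht1⟩
  choose t ht1 ht2 ht3 using hex
  have htlim : Tendsto t atTop (𝓝 ‖u‖) := by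
    refine tendsto_of_tendsto_of_tendsto_of_le_of_le tendsto_const_nhds ?_
      (fun k => (ht1 k).le) (fun k => (ht2 k).le)
    simpa using tendsto_const_nhds.add (tendsto_one_div_add_atTop_nhds_zero_nat (𝕜 := ℝ))
  have hlim : Tendsto (fun k => t k • e) atTop (𝓝 u) := by
    conv => rhs; rw [hue]
    exact htlim.smul_const e
  refine (hx _ _ (tendstoWeakly_of_tendsto hlim)).norm_le fun k => hgood _ ?_
  have : ‖t k • e‖ = t k := by
    rw [norm_smul, he, mul_one, Real.norm_of_nonneg ((norm_nonneg u).trans (ht1 k).le)]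
  rw [this]
  exact ht3 k

/-! ### Densities of functionals on `L^q` over a finite measure -/

theorem memLp_of_stronglyMeasurable_norm_le {Ω E : Type*} [MeasurableSpace Ω] {ν : Measure Ω}
    [IsFiniteMeasure ν] [NormedAddCommGroup E] {q : ℝ≥0∞} {k : Ω → E} (hk : StronglyMeasurable k)
    {C : ℝ} (hC : ∀ x, ‖k x‖ ≤ C) : MemLp k q ν :=
  MemLp.of_bound hk.aestronglyMeasurable C (Eventually.of_forall hC)

section LpFunctional

variable {Ω : Type*} [MeasurableSpace Ω] {ν : Measure Ω} [IsFiniteMeasure ν]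
  {E : Type*} [NormedAddCommGroup E] [NormedSpace ℝ E] {q : ℝ≥0∞} [Fact (1 ≤ q)]

/-- The value of a functional on `L^q` at a constant function cut off to a measurable set, as a
linear function of the constant. -/
noncomputable def indicatorConstFunctional (Φ : StrongDual ℝ (Lp E q ν)) {s : Set Ω}
    (hs : MeasurableSet s) : E →ₗ[ℝ] ℝ where
  toFun e := Φ (indicatorConstLp q hs (measure_ne_top ν s) e)
  map_add' x y := by rw [← indicatorConstLp_add, map_add]
  map_smul' r x := by
    have : indicatorConstLp q hs (measure_ne_top ν s) (r • x) =
        r • indicatorConstLp q hs (measure_ne_top ν s) x := by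
      rw [indicatorConstLp, indicatorConstLp, ← MemLp.toLp_const_smul]
      exact MemLp.toLp_congr _ _ (Eventually.of_forall fun ω => by
        simp [Set.indicator_const_smul_apply])
    rw [this, map_smul, RingHom.id_apply]

/-- Radon-Nikodym for the set function `s ↦ Φ (1_s e)`; it is countably additive because indicators
converge in `L^q` when `q` is finite. -/
theorem exists_scalar_density (hq : q ≠ ∞) (Φ : StrongDual ℝ (Lp E q ν)) (e : E) :
    ∃ φ : Ω → ℝ, Measurable φ ∧ Integrable φ ν ∧
      ∀ (s : Set Ω) (hs : MeasurableSet s), ∫ x in s, φ x ∂ν = indicatorConstFunctional Φ hs e := by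
  classical
  let m : SignedMeasure Ω :=
    { measureOf' := fun s => if hs : MeasurableSet s then indicatorConstFunctional Φ hs e else 0
      empty' := by
        rw [dif_pos MeasurableSet.empty]
        simp [indicatorConstFunctional]
      not_measurable' := fun s hs => dif_neg hs
      m_iUnion' := by
        intro f hf hd
        have hfin : ∀ t : Finset ℕ, MeasurableSet (⋃ i ∈ t, f i) :=
          fun t => t.measurableSet_biUnion fun i _ => hf i
        simp only [hf, MeasurableSet.iUnion hf, dite_true]
        have hsum : ∀ t : Finset ℕ, ∑ i ∈ t, indicatorConstFunctional Φ (hf i) e =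
            indicatorConstFunctional Φ (hfin t) e := by
          intro t
          induction t using Finset.induction_on with
          | empty => simp [indicatorConstFunctional]
          | insert a t ha ih =>
            rw [Finset.sum_insert ha, ih]
            have hdis : Disjoint (f a) (⋃ i ∈ t, f i) := by
              simp only [Set.disjoint_iUnion_right]
              exact fun i hi => hd fun h => ha (h ▸ hi)
            have := indicatorConstLp_disjoint_union (p := q) (hf a) (hfin t)
              (measure_ne_top ν _) (measure_ne_top ν _) hdis e
            simp only [indicatorConstFunctional, LinearMap.coe_mk, AddHom.coe_mk]
            rw [← map_add, ← this]
            congr 2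
            simp
        refine Tendsto.congr (fun t => (hsum t).symm) ?_
        refine (Φ.continuous.tendsto _).comp (tendsto_indicatorConstLp_set hq ?_)
        have hsub : ∀ t : Finset ℕ, ν (symmDiff (⋃ i ∈ t, f i) (⋃ i, f i)) =
            ν (⋃ i, f i) - ∑ i ∈ t, ν (f i) := by
          intro t
          have h1 : (⋃ i ∈ t, f i) ⊆ ⋃ i, f i := Set.iUnion₂_subset_iUnion _ _
          rw [Set.symmDiff_def, Set.sdiff_eq_empty.2 h1, Set.empty_union,
            measure_sdiff h1 (hfin t).nullMeasurableSet (measure_ne_top ν _),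
            measure_biUnion_finset (fun i _ j _ hij => hd hij) fun i _ => hf i]
        simp only [hsub]
        have h2 : HasSum (fun i => ν (f i)) (ν (⋃ i, f i)) := by
          rw [measure_iUnion hd hf]
          exact ENNReal.summable.hasSum
        have h3 := ENNReal.Tendsto.sub (tendsto_const_nhds (x := ν (⋃ i, f i))) h2
          (Or.inl (measure_ne_top ν _))
        simpa using h3 }
  have hm : ∀ (s : Set Ω) (hs : MeasurableSet s), m s = indicatorConstFunctional Φ hs e :=
    fun s hs => dif_pos hs
  have hac : m ≪ᵥ ν.toENNRealVectorMeasure := by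
    refine VectorMeasure.AbsolutelyContinuous.mk fun s hs h0 => ?_
    rw [Measure.toENNRealVectorMeasure_apply_measurable hs] at h0
    rw [hm s hs]
    have : indicatorConstLp q hs (measure_ne_top ν s) e = 0 := by
      rw [← norm_eq_zero, norm_indicatorConstLp (one_pos.trans_le Fact.out).ne' hq, measureReal_def,
        h0, ENNReal.toReal_zero, Real.zero_rpow, mul_zero]
      exact one_div_ne_zero
        (ENNReal.toReal_ne_zero.2 ⟨(one_pos.trans_le Fact.out).ne', hq⟩)
    simp [indicatorConstFunctional, this]
  refine ⟨m.rnDeriv ν, SignedMeasure.measurable_rnDeriv _ _, SignedMeasure.integrable_rnDeriv _ _,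
    fun s hs => ?_⟩
  rw [← hm s hs, ← withDensityᵥ_apply (SignedMeasure.integrable_rnDeriv _ _) hs,
    SignedMeasure.withDensityᵥ_rnDeriv_eq _ _ hac]

/-- The densities of a functional in the directions of countably many vectors of norm at most one
have an integrable common upper bound. -/
theorem exists_integrable_upper_bound (Φ : StrongDual ℝ (Lp E q ν)) (d : ℕ → E)
    (hd : ∀ n, ‖d n‖ ≤ 1) (ψ : ℕ → Ω → ℝ) (hψm : ∀ n, Measurable (ψ n))
    (hψi : ∀ n, Integrable (ψ n) ν)
    (hψ : ∀ (n : ℕ) (s : Set Ω) (hs : MeasurableSet s),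
      ∫ x in s, ψ n x ∂ν = indicatorConstFunctional Φ hs (d n)) :
    ∃ M : Ω → ℝ, Integrable M ν ∧ (∀ x, 0 ≤ M x) ∧ ∀ᵐ x ∂ν, ∀ n, ψ n x ≤ M x := by
  -- Running maxima of `0, ψ 0, ..., ψ (n - 1)`; starting from 0 makes the final bound nonnegative.
  let m : ℕ → Ω → ℝ := fun n => Nat.rec (fun _ => 0) (fun k g x => max (g x) (ψ k x)) n
  have hm0 : m 0 = fun _ => 0 := rfl
  have hms : ∀ n, m (n + 1) = fun x => max (m n x) (ψ n x) := fun n => rfl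
  have hmm : ∀ n, Measurable (m n) := by
    intro n
    induction n with
    | zero => exact measurable_const
    | succ n ih => exact ih.max (hψm n)
  have hmi : ∀ n, Integrable (m n) ν := by
    intro n
    induction n with
    | zero => exact integrable_zero _ _ _
    | succ n ih => exact ih.sup (hψi n)
  have hmono : ∀ x, Monotone fun n => m n x := fun x =>
    monotone_nat_of_le_succ fun n => le_max_left _ _
  have hmnn : ∀ n x, 0 ≤ m n x := fun n x => hmono x (Nat.zero_le n)
  -- `k x` records which vector (0 or some `d i`) attains the maximum at `x`. Hence `∫ m n` is the
  -- value of `Φ` at a function of norm at most 1 pointwise, which bounds it uniformly in `n`;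
  -- monotone convergence finishes.
  have key : ∀ n, ∃ k : Ω → E, StronglyMeasurable k ∧ (∀ x, ‖k x‖ ≤ 1) ∧
      ∀ (s : Set Ω) (_ : MeasurableSet s) (hk : MemLp (s.indicator k) q ν),
        ∫ x in s, m n x ∂ν = Φ (hk.toLp _) := by
    intro n
    induction n with
    | zero =>
      refine ⟨fun _ => 0, stronglyMeasurable_const, fun _ => by simp, fun s _ hk => ?_⟩
      have h0 : hk.toLp _ = 0 :=
        (MemLp.toLp_congr hk MemLp.zero (Eventually.of_forall fun x => by simp)).trans
          (MemLp.toLp_zero _)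
      rw [h0, map_zero, hm0, integral_zero]
    | succ n ih =>
      obtain ⟨k, hk, hk1, hkΦ⟩ := ih
      let P : Set Ω := {x | m n x < ψ n x}
      have hP : MeasurableSet P := measurableSet_lt (hmm n) (hψm n)
      have : DecidablePred (· ∈ P) := Classical.decPred _
      refine ⟨P.piecewise (fun _ => d n) k, stronglyMeasurable_const.piecewise hP hk, ?_, ?_⟩
      · intro x
        by_cases hx : x ∈ P
        · simpa [hx] using hd n
        · simpa [hx] using hk1 x
      · intro s hs hmem
        have hkm : MemLp ((s \ P).indicator k) q ν :=
          (memLp_of_stronglyMeasurable_norm_le hk hk1).indicator (hs.diff hP)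
        have h1 : ∫ x in s ∩ P, m (n + 1) x ∂ν = ∫ x in s ∩ P, ψ n x ∂ν :=
          setIntegral_congr_fun (hs.inter hP) fun x hx =>
            max_eq_right (le_of_lt (show m n x < ψ n x from hx.2))
        have h2 : ∫ x in s \ P, m (n + 1) x ∂ν = ∫ x in s \ P, m n x ∂ν :=
          setIntegral_congr_fun (hs.diff hP) fun x hx =>
            max_eq_left (not_lt.1 (show ¬ m n x < ψ n x from hx.2))
        rw [← integral_inter_add_sdiff hP (hmi (n + 1)).integrableOn, h1, h2,
          hψ n _ (hs.inter hP), hkΦ _ (hs.diff hP) hkm]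
        simp only [indicatorConstFunctional, LinearMap.coe_mk, AddHom.coe_mk]
        rw [← map_add, indicatorConstLp, ← MemLp.toLp_add]
        congr 1
        refine MemLp.toLp_congr _ _ (Eventually.of_forall fun x => ?_)
        by_cases hxs : x ∈ s <;> by_cases hxP : x ∈ P <;> simp [hxs, hxP, Set.indicator]
  let K : ℝ := ‖Φ‖ * (measureUnivNNReal ν ^ q.toReal⁻¹ * (1 : ℝ))
  have hint : ∀ n, ∫ x, m n x ∂ν ≤ K := by
    intro n
    obtain ⟨k, hk, hk1, hkΦ⟩ := key n
    have hmem : MemLp (Set.univ.indicator k) q ν :=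
      (memLp_of_stronglyMeasurable_norm_le hk hk1).indicator MeasurableSet.univ
    have h1 := hkΦ Set.univ MeasurableSet.univ hmem
    have h2 : ‖hmem.toLp _‖ ≤ measureUnivNNReal ν ^ q.toReal⁻¹ * (1 : ℝ) := by
      refine Lp.norm_le_of_ae_bound zero_le_one ?_
      filter_upwards [hmem.coeFn_toLp] with x hx
      rw [hx]
      simpa using hk1 x
    rw [setIntegral_univ] at h1
    rw [h1]
    exact (Real.le_norm_self _).trans ((Φ.le_opNorm _).trans
      (mul_le_mul_of_nonneg_left h2 (norm_nonneg _)))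
  have hmeas : ∀ n, Measurable fun x => ENNReal.ofReal (m n x) := fun n => (hmm n).ennreal_ofReal
  have hlint : ∫⁻ x, ⨆ n, ENNReal.ofReal (m n x) ∂ν ≠ ∞ := by
    rw [lintegral_iSup hmeas fun i j hij x => ENNReal.ofReal_le_ofReal (hmono x hij)]
    refine ne_top_of_le_ne_top (ENNReal.ofReal_ne_top (r := K)) (iSup_le fun n => ?_)
    rw [← ofReal_integral_eq_lintegral_ofReal (hmi n) (Eventually.of_forall (hmnn n))]
    exact ENNReal.ofReal_le_ofReal (hint n)
  refine ⟨fun x => (⨆ n, ENNReal.ofReal (m n x)).toReal,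
    integrable_toReal_of_lintegral_ne_top (Measurable.iSup hmeas).aemeasurable hlint,
    fun x => ENNReal.toReal_nonneg, ?_⟩
  filter_upwards [ae_lt_top (Measurable.iSup hmeas) hlint] with x hx n
  calc ψ n x ≤ m (n + 1) x := le_max_right _ _
    _ = (ENNReal.ofReal (m (n + 1) x)).toReal := (ENNReal.toReal_ofReal (hmnn (n + 1) x)).symm
    _ ≤ _ := ENNReal.toReal_mono hx.ne (le_iSup (fun n => ENNReal.ofReal (m n x)) (n + 1))

/-- On a separable set of vectors, a functional on `L^q` of a finite measure is represented by a
function with values in the dual space, with integrable norm bound. -/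
theorem exists_dual_density (hq : q ≠ ∞) (Φ : StrongDual ℝ (Lp E q ν)) (e : ℕ → E) :
    ∃ (F : Ω → StrongDual ℝ E) (M : Ω → ℝ), Integrable M ν ∧ (∀ᵐ x ∂ν, ‖F x‖ ≤ M x) ∧
      ∀ i, Integrable (fun x => F x (e i)) ν ∧ ∀ (s : Set Ω) (hs : MeasurableSet s),
        ∫ x in s, F x (e i) ∂ν = indicatorConstFunctional Φ hs (e i) := by
  choose φ hφm hφi hφ using fun i => exists_scalar_density hq Φ (e i)
  obtain ⟨enum, henum⟩ := exists_surjective_nat (Finset ℕ × ℕ)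
  let c : Finset ℕ × ℕ → ℕ → ℝ := fun j => TopologicalSpace.denseSeq (ℕ → ℝ) j.2
  let D : Finset ℕ × ℕ → E := fun j => ∑ i ∈ j.1, c j i • e i
  let χ : Finset ℕ × ℕ → Ω → ℝ := fun j x => ∑ i ∈ j.1, c j i * φ i x
  have hχm : ∀ j, Measurable (χ j) := fun j =>
    Finset.measurable_fun_sum _ fun i _ => (hφm i).const_mul _
  have hχi : ∀ j, Integrable (χ j) ν := fun j =>
    integrable_finsetSum _ fun i _ => (hφi i).const_mul _
  have hχ : ∀ (j) (s : Set Ω) (hs : MeasurableSet s),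
      ∫ x in s, χ j x ∂ν = indicatorConstFunctional Φ hs (D j) := by
    intro j s hs
    simp only [χ, D, map_sum, map_smul, ← hφ, smul_eq_mul]
    rw [integral_finsetSum _ fun i _ => ((hφi i).const_mul _).integrableOn]
    simp only [integral_const_mul]
  obtain ⟨M, hMi, hM0, hM⟩ := exists_integrable_upper_bound Φ
    (fun n => ‖D (enum n)‖⁻¹ • D (enum n))
    (fun n => by
      rw [norm_smul, norm_inv, norm_norm]
      exact inv_mul_le_one)
    (fun n x => ‖D (enum n)‖⁻¹ * χ (enum n) x) (fun n => (hχm _).const_mul _)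
    (fun n => (hχi _).const_mul _)
    (fun n s hs => by rw [integral_const_mul, hχ _ s hs, map_smul, smul_eq_mul])
  -- The normalised bound is void when `D j = 0`, so these linear relations between the densities
  -- are secured separately.
  have hzero : ∀ᵐ x ∂ν, ∀ j, D j = 0 → χ j x = 0 := by
    rw [ae_all_iff]
    intro j
    by_cases hj : D j = 0
    · have := (hχi j).ae_eq_zero_of_forall_setIntegral_eq_zero fun s hs _ => by
        rw [hχ j s hs, hj, map_zero]
      filter_upwards [this] with x hx _ using hx
    · exact Eventually.of_forall fun x h => absurd h hj
  have hF : ∀ x, ∃ F : StrongDual ℝ E, ((∀ n, ‖D (enum n)‖⁻¹ * χ (enum n) x ≤ M x) ∧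
      ∀ j, D j = 0 → χ j x = 0) → ‖F‖ ≤ M x ∧ ∀ i, F (e i) = φ i x := by
    intro x
    by_cases hx : (∀ n, ‖D (enum n)‖⁻¹ * χ (enum n) x ≤ M x) ∧ ∀ j, D j = 0 → χ j x = 0
    · obtain ⟨F, hF⟩ := exists_strongDual_apply_eq e (fun i => φ i x) (hM0 x) (fun s k => by
        change χ (s, k) x ≤ M x * ‖D (s, k)‖
        by_cases h0 : D (s, k) = 0
        · rw [hx.2 _ h0, h0, norm_zero, mul_zero]
        · obtain ⟨n, hn⟩ := henum (s, k)
          have := hx.1 n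
          rwa [hn, inv_mul_le_iff₀ (norm_pos_iff.2 h0), mul_comm] at this)
      exact ⟨F, fun _ => hF⟩
    · exact ⟨0, fun h => absurd h hx⟩
  -- The choice is made point by point: no measurability of `F` is claimed beyond that of the
  -- functions `F x (e i)`.
  choose F hF using hF
  have hae := hM.and hzero
  have hFe : ∀ i, (fun x => F x (e i)) =ᵐ[ν] φ i := fun i => by
    filter_upwards [hae] with x hx using (hF x hx).2 i
  refine ⟨F, M, hMi, by filter_upwards [hae] with x hx using (hF x hx).1, fun i =>
    ⟨(hφi i).congr (hFe i).symm, fun s hs => ?_⟩⟩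
  rw [← hφ i s hs]
  exact integral_congr_ae (ae_restrict_of_ae (hFe i))

end LpFunctional

/-! ### Integral representation and bounded weak convergence -/

section DualDensity

variable {Ω : Type*} [MeasurableSpace Ω] {ν : Measure Ω} [IsFiniteMeasure ν]
  {E : Type*} [NormedAddCommGroup E] [NormedSpace ℝ E] {q : ℝ≥0∞} [Fact (1 ≤ q)]

theorem integral_dual_density_simpleFunc (Φ : StrongDual ℝ (Lp E q ν)) {e : ℕ → E}
    {F : Ω → StrongDual ℝ E} (hFi : ∀ i, Integrable (fun x => F x (e i)) ν)
    (hF : ∀ (i : ℕ) (s : Set Ω) (hs : MeasurableSet s),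
      ∫ x in s, F x (e i) ∂ν = indicatorConstFunctional Φ hs (e i))
    (s : SimpleFunc Ω E) (hs : ∀ x, s x ∈ Set.range e) (hmem : MemLp s q ν) :
    Integrable (fun x => F x (s x)) ν ∧ ∫ x, F x (s x) ∂ν = Φ (hmem.toLp s) := by
  classical
  have hrange : ∀ y ∈ s.range, ∃ i, e i = y := by
    intro y hy
    obtain ⟨x, rfl⟩ := SimpleFunc.mem_range.1 hy
    exact hs x
  have hFy : ∀ y ∈ s.range, Integrable (fun x => F x y) ν ∧
      ∀ (t : Set Ω) (ht : MeasurableSet t),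
        ∫ x in t, F x y ∂ν = indicatorConstFunctional Φ ht y := by
    intro y hy
    obtain ⟨i, rfl⟩ := hrange y hy
    exact ⟨hFi i, hF i⟩
  have hdecomp : (fun x => F x (s x)) =
      fun x => ∑ y ∈ s.range, (s ⁻¹' {y}).indicator (fun x => F x y) x := by
    ext x
    rw [Finset.sum_eq_single (s x)]
    · simp
    · exact fun y _ hy => Set.indicator_of_notMem (fun h => hy h.symm) _
    · exact fun hx => absurd (s.mem_range_self x) hx
  have hint : ∀ y ∈ s.range, Integrable ((s ⁻¹' {y}).indicator fun x => F x y) ν :=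
    fun y hy => (hFy y hy).1.indicator (s.measurableSet_fiber y)
  have hLp : hmem.toLp s = ∑ y ∈ s.range,
      indicatorConstLp q (s.measurableSet_fiber y) (measure_ne_top ν _) y := by
    refine Lp.ext ?_
    have h1 : ∀ᵐ x ∂ν, ∀ y ∈ s.range,
        indicatorConstLp q (s.measurableSet_fiber y) (measure_ne_top ν _) y x =
          (s ⁻¹' {y}).indicator (fun _ => y) x :=
      (Finset.eventually_all _).2 fun y _ => indicatorConstLp_coeFn
    filter_upwards [hmem.coeFn_toLp, h1, Lp.coeFn_finsetSum s.range fun y =>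
      indicatorConstLp q (s.measurableSet_fiber y) (measure_ne_top ν _) y] with x hx1 hx2 hx3
    rw [hx1, hx3, Finset.sum_apply, Finset.sum_congr rfl hx2, Finset.sum_eq_single (s x)]
    · simp
    · exact fun y _ hy => Set.indicator_of_notMem (fun h => hy h.symm) _
    · exact fun hx => absurd (s.mem_range_self x) hx
  refine ⟨by rw [hdecomp]; exact integrable_finsetSum _ hint, ?_⟩
  rw [hdecomp, integral_finsetSum _ hint, hLp, map_sum]
  refine Finset.sum_congr rfl fun y hy => ?_
  rw [integral_indicator (s.measurableSet_fiber y), (hFy y hy).2 _ (s.measurableSet_fiber y)]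
  rfl

/-- Approximation by simple functions with values in `Set.range e`. The bound on `k` matters because
`M` is merely integrable; `e 0 = 0` supplies a base point for which the approximants have norm at
most `2 * ‖k x‖`. -/
theorem integral_dual_density (hq : q ≠ ∞) (Φ : StrongDual ℝ (Lp E q ν)) {e : ℕ → E}
    (he : e 0 = 0) {F : Ω → StrongDual ℝ E} {M : Ω → ℝ} (hM : Integrable M ν)
    (hFM : ∀ᵐ x ∂ν, ‖F x‖ ≤ M x)
    (hFi : ∀ i, Integrable (fun x => F x (e i)) ν)
    (hF : ∀ (i : ℕ) (s : Set Ω) (hs : MeasurableSet s),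
      ∫ x in s, F x (e i) ∂ν = indicatorConstFunctional Φ hs (e i))
    {k : Ω → E} (hk : MemLp k q ν) {C : ℝ} (hkC : ∀ᵐ x ∂ν, ‖k x‖ ≤ C)
    (hke : ∀ᵐ x ∂ν, k x ∈ closure (Set.range e)) :
    AEStronglyMeasurable (fun x => F x (k x)) ν ∧ ∫ x, F x (k x) ∂ν = Φ (hk.toLp k) := by
  borelize E
  let g := hk.1.mk k
  have hgk : k =ᵐ[ν] g := hk.1.ae_eq_mk
  have hgm : Measurable g := hk.1.stronglyMeasurable_mk.measurable
  have hg : MemLp g q ν := hk.ae_eq hgk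
  have h0 : (0 : E) ∈ Set.range e := ⟨0, he⟩
  have : TopologicalSpace.SeparableSpace (Set.range e) :=
    (Set.countable_range e).isSeparable.separableSpace
  let a : ℕ → SimpleFunc Ω E := fun n => SimpleFunc.approxOn g hgm (Set.range e) 0 h0 n
  have hge : ∀ᵐ x ∂ν, g x ∈ closure (Set.range e) := by
    filter_upwards [hke, hgk] with x hx hxg using hxg ▸ hx
  have hamem : ∀ n, MemLp (a n) q ν := fun n => (a n).memLp_of_isFiniteMeasure q ν
  have hrep := fun n => integral_dual_density_simpleFunc Φ hFi hF (a n)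
    (fun x => SimpleFunc.approxOn_mem hgm h0 n x) (hamem n)
  have hlim : ∀ᵐ x ∂ν, Tendsto (fun n => F x (a n x)) atTop (𝓝 (F x (k x))) := by
    filter_upwards [hge, hgk] with x hx hxg
    rw [hxg]
    exact ((F x).continuous.tendsto _).comp (SimpleFunc.tendsto_approxOn hgm h0 hx)
  have hbd : ∀ n, ∀ᵐ x ∂ν, ‖F x (a n x)‖ ≤ M x * (C + C) := by
    intro n
    filter_upwards [hFM, hkC, hgk] with x hxF hxC hxg
    have h1 : ‖a n x‖ ≤ C + C := by
      refine (SimpleFunc.norm_approxOn_zero_le hgm h0 x n).trans ?_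
      rw [← hxg]
      linarith
    exact (F x).le_of_opNorm_le_of_le hxF h1
  have hconv : Tendsto (fun n => (hamem n).toLp (a n)) atTop (𝓝 (hg.toLp g)) := by
    refine (Lp.tendsto_Lp_iff_tendsto_eLpNorm'' _ hamem _ hg).2 ?_
    exact SimpleFunc.tendsto_approxOn_Lp_eLpNorm hgm h0 hq hge (by simpa using hg.2)
  refine ⟨aestronglyMeasurable_of_tendsto_ae atTop (fun n => (hrep n).1.1) hlim, ?_⟩
  have h2 := tendsto_integral_of_dominated_convergence _ (fun n => (hrep n).1.1)
    (hM.mul_const (C + C)) hbd hlim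
  simp only [(hrep _).2] at h2
  rw [tendsto_nhds_unique h2 ((Φ.continuous.tendsto _).comp hconv)]
  congr 1
  exact MemLp.toLp_congr _ _ hgk.symm

/-- Over a finite measure space, a uniformly bounded sequence that converges weakly almost
everywhere converges weakly in `L^q`. -/
theorem tendstoWeakly_toLp_of_ae_bounded (hq : q ≠ ∞) {g : ℕ → Ω → E} {a : Ω → E}
    (hg : ∀ n, MemLp (g n) q ν) (ha : MemLp a q ν) {C : ℝ} (hgC : ∀ n, ∀ᵐ x ∂ν, ‖g n x‖ ≤ C)
    (haC : ∀ᵐ x ∂ν, ‖a x‖ ≤ C) (h : ∀ᵐ x ∂ν, TendstoWeakly (fun n => g n x) (a x)) :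
    TendstoWeakly (fun n => (hg n).toLp (g n)) (ha.toLp a) := by
  refine tendstoWeakly_iff.2 fun Φ => ?_
  obtain ⟨t, ht, hat⟩ := ha.1.isSeparable_ae_range
  choose s hs hgs using fun n => (hg n).1.isSeparable_ae_range
  obtain ⟨c, hc, hcl⟩ := ht.union (TopologicalSpace.IsSeparable.iUnion hs)
  -- Here 0 is inserted only to have a nonempty set to enumerate; `e'` then places 0 at index 0.
  obtain ⟨e, he⟩ := (hc.insert 0).exists_eq_range (Set.insert_nonempty _ _)
  let e' : ℕ → E := fun n => Nat.casesOn n 0 e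
  have hce : c ⊆ Set.range e' := by
    intro y hy
    obtain ⟨i, rfl⟩ : y ∈ Set.range e := he ▸ Set.mem_insert_of_mem _ hy
    exact ⟨i + 1, rfl⟩
  have hcl' := hcl.trans (closure_mono hce)
  obtain ⟨F, M, hM, hFM, hF⟩ := exists_dual_density hq Φ e'
  have hrepa := integral_dual_density hq Φ (e := e') rfl hM hFM (fun i => (hF i).1)
    (fun i => (hF i).2) ha haC (by filter_upwards [hat] with x hx using hcl' (Or.inl hx))
  have hrepg := fun n => integral_dual_density hq Φ (e := e') rfl hM hFM (fun i => (hF i).1)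
    (fun i => (hF i).2) (hg n) (hgC n)
    (by filter_upwards [hgs n] with x hx using hcl' (Or.inr (Set.mem_iUnion.2 ⟨n, hx⟩)))
  simp only [← hrepa.2, ← (hrepg _).2]
  refine tendsto_integral_of_dominated_convergence (fun x => M x * C) (fun n => (hrepg n).1)
    (hM.mul_const C) (fun n => ?_) ?_
  · filter_upwards [hFM, hgC n] with x hx1 hx2 using (F x).le_of_opNorm_le_of_le hx1 hx2
  · filter_upwards [h] with x hx using tendstoWeakly_iff.1 hx (F x)

end DualDensity

/-! ### From finite measure and bounded functions to domination in `L^q` -/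

section Extension

variable {Ω : Type*} [MeasurableSpace Ω] {μ : Measure Ω}
  {E : Type*} [NormedAddCommGroup E] [NormedSpace ℝ E] {q : ℝ≥0∞} [Fact (1 ≤ q)]

/-- Extension by zero from a measurable set, on `L^q`. -/
noncomputable def lpExtendByZero {B : Set Ω} (hB : MeasurableSet B) :
    Lp E q (μ.restrict B) →L[ℝ] Lp E q μ :=
  LinearMap.mkContinuous
    { toFun := fun g => ((memLp_indicator_iff_restrict hB).2 (Lp.memLp g)).toLp (B.indicator g)
      map_add' := fun g g' => by
        rw [← MemLp.toLp_add]
        refine MemLp.toLp_congr _ _ ?_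
        filter_upwards [(ae_restrict_iff' hB).1 (Lp.coeFn_add g g')] with x hx
        by_cases hxB : x ∈ B
        · simpa [hxB] using hx hxB
        · simp [hxB]
      map_smul' := fun r g => by
        rw [RingHom.id_apply, ← MemLp.toLp_const_smul]
        refine MemLp.toLp_congr _ _ ?_
        filter_upwards [(ae_restrict_iff' hB).1 (Lp.coeFn_smul r g)] with x hx
        by_cases hxB : x ∈ B
        · simpa [hxB] using hx hxB
        · simp [hxB] }
    1 fun g => by
      rw [one_mul]
      refine le_of_eq ?_
      change ‖((memLp_indicator_iff_restrict hB).2 (Lp.memLp g)).toLp (B.indicator g)‖ = _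
      rw [Lp.norm_toLp, eLpNorm_indicator_eq_eLpNorm_restrict hB, Lp.norm_def]

theorem lpExtendByZero_apply {B : Set Ω} (hB : MeasurableSet B) (g : Lp E q (μ.restrict B)) :
    lpExtendByZero hB g = ((memLp_indicator_iff_restrict hB).2 (Lp.memLp g)).toLp (B.indicator g) :=
  rfl

theorem lpExtendByZero_toLp {B : Set Ω} (hB : MeasurableSet B) {g : Ω → E}
    (hg : MemLp g q (μ.restrict B)) (hg' : MemLp (B.indicator g) q μ) :
    lpExtendByZero hB (hg.toLp g) = hg'.toLp (B.indicator g) := by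
  rw [lpExtendByZero_apply, MemLp.toLp_eq_toLp_iff]
  filter_upwards [(ae_restrict_iff' hB).1 hg.coeFn_toLp] with x hx
  by_cases hxB : x ∈ B
  · simpa [hxB] using hx hxB
  · simp [hxB]

/-- An `L^q` function is bounded on some set of finite measure, with small norm outside. -/
theorem MeasureTheory.MemLp.exists_bounded_and_eLpNorm_compl_le (hq : q ≠ ∞) {h : Ω → ℝ}
    (hh : MemLp h q μ) (hhm : StronglyMeasurable h) {ε : ℝ} (hε : 0 < ε) :
    ∃ B : Set Ω, MeasurableSet B ∧ μ B < ∞ ∧ (∃ C : ℝ, ∀ x ∈ B, ‖h x‖ ≤ C) ∧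
      eLpNorm (Bᶜ.indicator h) q μ ≤ ENNReal.ofReal ε := by
  obtain ⟨S, hS, hSμ, hSε⟩ := hh.exists_eLpNorm_indicator_compl_lt hq
    (ε := ENNReal.ofReal (ε / 2)) (by simpa using hε)
  obtain ⟨C, hC⟩ := hh.eLpNorm_indicator_norm_ge_le hhm (half_pos hε)
  let P : Set Ω := {x | C ≤ ‖h x‖₊}
  have hP : MeasurableSet P := measurableSet_le measurable_const hhm.norm.measurable
  refine ⟨S \ P, hS.diff hP, (measure_mono Set.sdiff_subset).trans_lt hSμ,
    ⟨C, fun x hx => (not_le.1 (show ¬ C ≤ ‖h x‖ from hx.2)).le⟩, ?_⟩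
  have hle : ∀ x, ‖(S \ P)ᶜ.indicator h x‖ ≤
      ‖((fun x => ‖Sᶜ.indicator h x‖) + fun x => ‖P.indicator h x‖) x‖ := by
    intro x
    simp only [Pi.add_apply]
    rw [Real.norm_of_nonneg (add_nonneg (norm_nonneg _) (norm_nonneg _))]
    by_cases hxS : x ∈ S <;> by_cases hxP : x ∈ P <;>
      simp [hxS, hxP]
  calc eLpNorm ((S \ P)ᶜ.indicator h) q μ
      ≤ eLpNorm ((fun x => ‖Sᶜ.indicator h x‖) + fun x => ‖P.indicator h x‖) q μ :=
        eLpNorm_mono hle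
    _ ≤ eLpNorm (fun x => ‖Sᶜ.indicator h x‖) q μ + eLpNorm (fun x => ‖P.indicator h x‖) q μ :=
        eLpNorm_add_le (hh.1.indicator hS.compl).norm (hh.1.indicator hP).norm Fact.out
    _ ≤ ENNReal.ofReal (ε / 2) + ENNReal.ofReal (ε / 2) := by
        rw [eLpNorm_norm, eLpNorm_norm]
        exact add_le_add hSε.le hC
    _ = ENNReal.ofReal ε := by
        rw [← ENNReal.ofReal_add (half_pos hε).le (half_pos hε).le, add_halves]

/-- A sequence that is dominated in `L^q` and converges weakly almost everywhere converges weakly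
in `L^q`. -/
theorem tendstoWeakly_toLp_of_ae_dominated (hq : q ≠ ∞) {g : ℕ → Ω → E} {a : Ω → E}
    (hg : ∀ n, MemLp (g n) q μ) (ha : MemLp a q μ) {h : Ω → ℝ} (hh : MemLp h q μ)
    (hgh : ∀ n, ∀ᵐ x ∂μ, ‖g n x‖ ≤ h x) (hah : ∀ᵐ x ∂μ, ‖a x‖ ≤ h x)
    (hlim : ∀ᵐ x ∂μ, TendstoWeakly (fun n => g n x) (a x)) :
    TendstoWeakly (fun n => (hg n).toLp (g n)) (ha.toLp a) := by
  refine tendstoWeakly_iff.2 fun Φ => ?_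
  let h' := hh.1.mk h
  have hhh' : h =ᵐ[μ] h' := hh.1.ae_eq_mk
  rw [Metric.tendsto_atTop]
  intro ε hε
  -- Makes `‖Φ‖ * δ < ε / 3`; the `+ 1` covers `Φ = 0`. Two tails and the convergence on `B` each
  -- cost a third of `ε`.
  let δ : ℝ := ε / (3 * (‖Φ‖ + 1))
  have hδ : 0 < δ := by positivity
  obtain ⟨B, hB, hBμ, ⟨C, hC⟩, hBδ⟩ := (hh.ae_eq hhh').exists_bounded_and_eLpNorm_compl_le hq
    hh.1.stronglyMeasurable_mk hδ
  have : IsFiniteMeasure (μ.restrict B) := isFiniteMeasure_restrict.2 hBμ.ne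
  have hbound : ∀ k : Ω → E, (∀ᵐ x ∂μ, ‖k x‖ ≤ h x) → ∀ᵐ x ∂(μ.restrict B), ‖k x‖ ≤ C := by
    intro k hk
    rw [ae_restrict_iff' hB]
    filter_upwards [hk, hhh'] with x hx1 hx2 hxB
    exact (hx1.trans (hx2.le.trans (Real.le_norm_self _))).trans (hC x hxB)
  have htail : ∀ (k : Ω → E) (hk : MemLp k q μ), (∀ᵐ x ∂μ, ‖k x‖ ≤ h x) →
      ‖Φ (hk.toLp k) - Φ (lpExtendByZero hB ((hk.restrict B).toLp k))‖ ≤ ‖Φ‖ * δ := by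
    intro k hk hkh
    rw [lpExtendByZero_toLp hB _ (hk.indicator hB), ← map_sub, ← MemLp.toLp_sub]
    refine (Φ.le_opNorm _).trans (mul_le_mul_of_nonneg_left ?_ (norm_nonneg _))
    rw [Lp.norm_toLp]
    refine ENNReal.toReal_le_of_le_ofReal hδ.le (le_trans (eLpNorm_mono_ae ?_) hBδ)
    filter_upwards [hkh, hhh'] with x hx1 hx2
    by_cases hxB : x ∈ B
    · simp [hxB]
    · have : ‖k x‖ ≤ ‖h' x‖ := hx1.trans (hx2.le.trans (Real.le_norm_self _))
      simpa [hxB] using this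
  have hconv := (tendstoWeakly_toLp_of_ae_bounded hq (fun n => (hg n).restrict B) (ha.restrict B)
    (fun n => hbound _ (hgh n)) (hbound _ hah) (ae_restrict_of_ae hlim)).map (lpExtendByZero hB)
  obtain ⟨N, hN⟩ := Metric.tendsto_atTop.1 (tendstoWeakly_iff.1 hconv Φ) (ε / 3) (by positivity)
  refine ⟨N, fun n hn => ?_⟩
  have h1 := htail (g n) (hg n) (hgh n)
  have h2 := htail a ha hah
  have h3 := hN n hn
  have h4 : ‖Φ‖ * δ < ε / 3 := by
    have : (‖Φ‖ + 1) * δ = ε / 3 := by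
      simp only [δ]
      field_simp
    linarith
  rw [Real.dist_eq] at h3 ⊢
  rw [Real.norm_eq_abs] at h1 h2
  rw [abs_le] at h1 h2
  rw [abs_lt] at h3 ⊢
  constructor <;> linarith [h1.1, h1.2, h2.1, h2.2, h3.1, h3.2]

end Extension

/-! ### The main theorem -/

theorem lemma7p10 {Ω : Type*} [MeasurableSpace Ω] (μ : Measure Ω)
    {E : Type*} [NormedAddCommGroup E] [NormedSpace ℝ E] [CompleteSpace E] (hE : IsReflexive E)
    (p q : ℝ≥0∞) [Fact (1 ≤ p)] [Fact (1 ≤ q)] (hq_top : q ≠ ∞)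
    (hpq : 1 < q ∨ (p = 1 ∧ q = 1))
    (I : Lp E p μ →L[ℝ] Lp E ∞ μ)
    (f : Ω → E → E) (hf : IsWeakCaratheodory μ f)
    (A : Ω → ℝ) (hA : MemLp A q μ) (ψ : ℝ → ℝ) (hψ : MemLinftyLoc ψ)
    (hbound : ∀ᵐ x ∂μ, ∀ u : E, ‖f x u‖ ≤ A x * ψ ‖u‖) :
    ∃ hmem : ∀ u : Lp E p μ, MemLp (nemytskii f (I u)) q μ,
      SeqWeaklyContinuous (fun u : Lp E p μ => (hmem u).toLp (nemytskii f (I u))) := by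
  have hdom : ∀ R : ℝ, ∃ C : ℝ, 0 ≤ C ∧ ∀ w : Lp E ∞ μ, ‖w‖ ≤ R →
      ∀ᵐ x ∂μ, ‖nemytskii f w x‖ ≤ C * ‖A x‖ := by
    intro R
    obtain ⟨C, hC0, hC⟩ := hf.exists_norm_le hψ hbound R
    refine ⟨C, hC0, fun w hw => ?_⟩
    filter_upwards [hC, Lp.ae_norm_le_norm_top w] with x hx1 hx2 using hx1 _ (hx2.trans hw)
  have hmem : ∀ w : Lp E ∞ μ, MemLp (nemytskii f w) q μ := by
    intro w
    obtain ⟨C, -, hC⟩ := hdom ‖w‖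
    refine (hA.norm.const_mul C).mono'
      (hf.aestronglyMeasurable_nemytskii (Lp.aestronglyMeasurable w)) (hC w le_rfl)
  refine ⟨fun u => hmem (I u), fun v a hv => ?_⟩
  have hw := hv.map I
  -- Weakly convergent sequences are bounded, and the same `R` bounds the limit, so one multiple of
  -- `|A|` dominates all the images.
  obtain ⟨R, hR⟩ := hw.exists_norm_le
  obtain ⟨C, -, hC⟩ := hdom R
  refine tendstoWeakly_toLp_of_ae_dominated hq_top (fun n => hmem (I (v n))) (hmem (I a))
    (hA.norm.const_mul C) (fun n => hC _ (hR n)) (hC _ (hw.norm_le hR)) ?_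
  filter_upwards [hw.ae_of_Lp_top, hf.seqWeaklyContinuous] with x hx1 hx2 using hx2 _ _ hx1
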